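/- There are absolute constants $c_1,c_2,c_3>0$ for which the following holds; put $\beta(\epsilon,\delta,s):=e^{-s\epsilon^2}+c_3\,s\sqrt{\delta/\epsilon}$. Let $\Theta,\mathcal X,\mathcal Y$ be measurable spaces, let $\mathcal D$ be a probability measure on $\mathcal X\times\mathcal Y$, fix a hyperparameter $\lambda$, and let $\ell(\theta;x,y,\lambda)\in[0,1]$ be a loss that is jointly measurable in $(\theta,x,y)$. Put $R(\theta)=\mathbb E_{(x,y)\sim\mathcal D}[\ell(\theta;x,y,\lambda)]$ and, for a data set $S=((x_i,y_i))_{i=1}^s$ with $s\ge 1$, $\hat R(\theta;S)=\frac1s\sum_{i=1}^s\ell(\theta;x_i,y_i,\lambda)$. Let $\epsilon\in(0,\tfrac12]$ and $\delta\in(0,\epsilon)$ be such that $\beta(\epsilon,\delta,s)<1$. Let $P=P_S$ be a data-dependent prior, that is, a Markov kernel from $(\mathcal X\times\mathcal Y)^s$ to $\Theta$, that is $(\epsilon,\delta)$-differentially private: $P_{S_1}(I)\le e^{\epsilon}P_{S_2}(I)+\delta$ for every measurable $I\subseteq\Theta$ and all data sets $S_1,S_2$ of size $s$ that differ in at most one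 entry. Let $\Delta\in(0,1)$. Then, with probability at least $1-\Delta$ over $S\sim\mathcal D^s$, simultaneously for all probability measures $Q$ on $\Theta$ (which may depend on $S$), $$\mathbb E_Q[R(\theta)]\le\mathbb E_Q[\hat R(\theta;S)]+\left\{\frac1{2s-1}\left(\mathrm{KL}(Q\|P_S)+\log\frac{4s\,e^{s\left(c_1\epsilon^2+c_2\sqrt{\delta/\epsilon}\right)}+\beta(\epsilon,\delta,s)\,e^{2s}}{\Delta}\right)\right\}^{1/2}.$$ If moreover $\beta(\epsilon,\delta,s)<\min\left(1,\;s\exp\left\{s\left(c_1\epsilon^2+c_2\sqrt{\delta/\epsilon}-2\right)\right\}\right)$, then with probability at least $1-\Delta$ over $S\sim\mathcal D^s$, simultaneously for all probability measures $Q$ on $\Theta$, $$\mathbb E_Q[R(\theta)]\le\mathbb E_Q[\hat R(\theta;S)]+\left\{\frac1{2s-1}\left(\mathrm{KL}(Q\|P_S)+\log\frac{5s}{\Delta}\right)+c_1\epsilon^2+c_2\sqrt{\frac{\delta}{\epsilon}}\right\}^{1/2}.$$ (The bounds are read as trivially true when $\mathrm{KL}(Q\|P_S)=\infty$.) -/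

import Mathlib

open MeasureTheory ProbabilityTheory

/-- The empirical risk `R̂(θ; S, lam)`: the average of the loss over the `s` points of `S`. -/
noncomputable def empiricalRisk {Θ X Y Λ : Type*} (ℓ : Θ → X → Y → Λ → ℝ) (lam : Λ)
    {s : ℕ} (S : Fin s → X × Y) (θ : Θ) : ℝ :=
  (1 / (s : ℝ)) * ∑ i, ℓ θ (S i).1 (S i).2 lam

/-- The expected risk `R(θ; D, lam)`: the expectation of the loss under the data law `D`. -/
noncomputable def expectedRisk {Θ X Y Λ : Type*} [MeasurableSpace X] [MeasurableSpace Y]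
    (ℓ : Θ → X → Y → Λ → ℝ) (lam : Λ) (D : Measure (X × Y)) (θ : Θ) : ℝ :=
  ∫ z, ℓ θ z.1 z.2 lam ∂D

/-- Two data sets of size `s` are adjacent if they agree except possibly in one entry. -/
def AdjacentData {Z : Type*} {s : ℕ} (S₁ S₂ : Fin s → Z) : Prop :=
  ∃ i, ∀ j, j ≠ i → S₁ j = S₂ j

/-- A randomized algorithm, given as the Markov kernel sending a data set to the law of the
output, is `(ε, δ)`-differentially private. -/
def IsDP {Z Θ : Type*} [MeasurableSpace Z] [MeasurableSpace Θ] {s : ℕ}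
    (P : Kernel (Fin s → Z) Θ) (ε δ : ℝ) : Prop :=
  ∀ S₁ S₂ : Fin s → Z, AdjacentData S₁ S₂ → ∀ I : Set Θ, MeasurableSet I →
    P S₁ I ≤ ENNReal.ofReal (Real.exp ε) * P S₂ I + ENNReal.ofReal δ

/-- `β(ε, δ, s) = exp(-s ε²) + O(s √(δ/ε))`, where `c` is the constant hidden in the `O`. -/
noncomputable def privacyBeta (c ε δ : ℝ) (s : ℕ) : ℝ :=
  Real.exp (-((s : ℝ) * ε ^ 2)) + c * ((s : ℝ) * √(δ / ε))

/-- The event `A` (not assumed measurable) holds with probability at least `p`: it contains a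
measurable event of probability at least `p`. -/
def HoldsWithProbAtLeast {Ω : Type*} [MeasurableSpace Ω] (μ : Measure Ω) (p : ℝ)
    (A : Set Ω) : Prop :=
  ∃ G : Set Ω, MeasurableSet G ∧ G ⊆ A ∧ ENNReal.ofReal p ≤ μ G

/-!
For a fixed parameter `θ` put `g = R(θ) - R̂(θ; S)`. By Hoeffding's lemma `g` is sub-Gaussian with
variance proxy `1 / (4 s)`, so `exp ((2 s - 1) g²)` has mean at most `4 s`
(`lintegral_exp_sq_integral_sub_average_le`). If the same exponential moment, taken under the joint
law of `S` and `θ ∼ P_S`, is at most `A`, Markov's inequality bounds `∫ exp ((2 s - 1) g²) dP_S` by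
`A / Δ` with probability `1 - Δ`, and the Donsker–Varadhan and Jensen inequalities turn this into a
bound for all `Q` simultaneously (`integral_le_sqrt_klDiv_add_log`).

It remains to pass from independent `S` and `θ` to `θ ∼ P_S`. For this a data-independent prior `M`
is constructed, namely `P_S` averaged over `S`, such that the joint law has a density `ρ` with
respect to `Dˢ ⊗ M` with `∫ ρ² ≤ (1 + 16 ε² + √(δ / ε))ˢ`, up to a mass of `8 s √(δ / ε)`
(`exists_subdensity_of_isDP`). Splitting at `ρ = exp (s (17 ε² + √(δ / ε)))` then costs this factor
where `ρ` is small, and at most `exp (-s ε²)` of the mass where `ρ` is large. Since the exponential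
moment is bounded by `exp (2 s)`, these losses make up the term `β exp (2 s)`.

The density is built one data point at a time, by redrawing the points in turn. Privacy puts each
likelihood ratio within `exp (± 2 ε)` off a set of mass `O(δ / ε)`
(`rnDeriv_mem_exp_Icc_off_small`). Given the other data points and `θ`, the ratio has mean at most
one over the redrawn point; hence its second moment is `1 + O(ε²)` rather than `1 + O(ε)`, once the
fibres with more than `√(δ / ε)` of exceptional mass are removed
(`exists_subdensity_of_indistinguishable_prod`). Working with Radon–Nikodym derivatives of the
joint laws, instead of those of the individual laws `P_S`, makes the densities jointly measurable
without any assumption on the measurable spaces.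
-/

/-! ### Exponential moments and the change-of-measure inequality -/

/-- `exp (a X²)` is a Gaussian mixture of the exponentials `exp (t X)`, so a sub-Gaussian
moment generating function controls it. -/
theorem lintegral_exp_mul_sq_le_of_hasSubgaussianMGF {Ω : Type*} [MeasurableSpace Ω]
    {μ : Measure Ω} [IsProbabilityMeasure μ] {X : Ω → ℝ} {c : NNReal} (hXm : Measurable X)
    (hX : HasSubgaussianMGF X c μ) {a : ℝ} (ha : 0 ≤ a) (hac : 2 * a * c < 1) :
    ∫⁻ ω, ENNReal.ofReal (Real.exp (a * X ω ^ 2)) ∂μ ≤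
      ENNReal.ofReal (√(1 / (1 - 2 * a * c))) := by
  have hsq : √(2 * a) ^ 2 = 2 * a := Real.sq_sqrt (by positivity)
  -- the Gaussian moment generating function at `√(2 a) y` is `exp (a y²)`
  have hmix : ∀ y : ℝ, ENNReal.ofReal (Real.exp (a * y ^ 2)) =
      ∫⁻ x, ENNReal.ofReal (Real.exp ((√(2 * a) * y) * x)) ∂(gaussianReal 0 1) := by
    intro y
    rw [← ofReal_integral_eq_lintegral_ofReal (integrable_exp_mul_gaussianReal _)
      (ae_of_all _ fun x => (Real.exp_pos _).le)]
    have h := congrFun (mgf_id_gaussianReal (μ := 0) (v := 1)) (√(2 * a) * y)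
    simp only [mgf, id] at h
    rw [h, mul_pow, hsq]
    congr 2
    simp
    ring
  simp_rw [hmix]
  rw [lintegral_lintegral_swap (by fun_prop)]
  calc ∫⁻ x, ∫⁻ ω, ENNReal.ofReal (Real.exp (√(2 * a) * X ω * x)) ∂μ ∂(gaussianReal 0 1)
      ≤ ∫⁻ x, ENNReal.ofReal (Real.exp (a * c * x ^ 2)) ∂(gaussianReal 0 1) := by
        refine lintegral_mono fun x => ?_
        have h1 : ∀ ω, √(2 * a) * X ω * x = (√(2 * a) * x) * X ω := fun ω => by ring
        simp_rw [h1]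
        rw [← ofReal_integral_eq_lintegral_ofReal (hX.integrable_exp_mul _)
          (ae_of_all _ fun x => (Real.exp_pos _).le)]
        refine ENNReal.ofReal_le_ofReal ((hX.mgf_le _).trans (le_of_eq ?_))
        rw [mul_pow, hsq]
        congr 1
        ring
    _ = ∫⁻ x, ENNReal.ofReal ((√(2 * Real.pi))⁻¹ * Real.exp (-(1 / 2 - a * c) * x ^ 2)) := by
        rw [gaussianReal_of_var_ne_zero 0 one_ne_zero,
          lintegral_withDensity_eq_lintegral_mul _ (by fun_prop) (by fun_prop)]
        refine lintegral_congr fun x => ?_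
        simp only [Pi.mul_apply, gaussianPDF, gaussianPDFReal]
        rw [← ENNReal.ofReal_mul (by positivity), mul_assoc, ← Real.exp_add]
        congr 3
        · simp
        · simp; ring
    _ = ENNReal.ofReal (√(1 / (1 - 2 * a * c))) := by
        rw [← ofReal_integral_eq_lintegral_ofReal
          ((integrable_exp_neg_mul_sq (by linarith)).const_mul _)
          (ae_of_all _ fun x => by positivity), integral_const_mul, integral_gaussian,
          ← Real.sqrt_inv, ← Real.sqrt_mul (by positivity)]
        congr 2
        have h2 : 1 - 2 * a * c ≠ 0 := by linarith
        have h3 : 1 / 2 - a * c ≠ 0 := by intro h; apply h2; linarith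
        field_simp

/-- The Donsker–Varadhan variational inequality, for a function `f` integrable under `Q`. -/
theorem integral_le_klDiv_add_log_integral_exp {Θ : Type*} [MeasurableSpace Θ]
    {Q P : Measure Θ} [IsProbabilityMeasure Q] [IsProbabilityMeasure P] {f : Θ → ℝ}
    (hfQ : Integrable f Q) (hfP : Integrable (fun θ => Real.exp (f θ)) P)
    (hKL : InformationTheory.klDiv Q P ≠ ⊤) :
    ∫ θ, f θ ∂Q ≤
      (InformationTheory.klDiv Q P).toReal + Real.log (∫ θ, Real.exp (f θ) ∂P) := by
  obtain ⟨hac, hint⟩ := InformationTheory.klDiv_ne_top_iff.1 hKL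
  have h1 := integral_llr_tilted_right hac hfQ hfP hint
  have : IsProbabilityMeasure (P.tilted f) := isProbabilityMeasure_tilted hfP
  have h2 := InformationTheory.toReal_klDiv_of_measure_eq
    (hac.trans (absolutelyContinuous_tilted hfP)) (by simp)
  rw [h1, ← InformationTheory.toReal_klDiv_of_measure_eq hac (by simp)] at h2
  have h3 : 0 ≤ (InformationTheory.klDiv Q (P.tilted f)).toReal := ENNReal.toReal_nonneg
  linarith

/-- Jensen and Donsker–Varadhan: a bound on the exponential moment of `c g²` under `P` bounds the
mean of `g` under every `Q`. -/
theorem integral_le_sqrt_klDiv_add_log {Θ : Type*} [MeasurableSpace Θ]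
    {Q P : Measure Θ} [IsProbabilityMeasure Q] [IsProbabilityMeasure P] {g : Θ → ℝ}
    (hgm : Measurable g) (hg : ∀ θ, g θ ∈ Set.Icc (-1 : ℝ) 1) {c A : ℝ} (hc : 0 < c)
    (hA : ∫⁻ θ, ENNReal.ofReal (Real.exp (c * g θ ^ 2)) ∂P ≤ ENNReal.ofReal A)
    (hKL : InformationTheory.klDiv Q P ≠ ⊤) :
    ∫ θ, g θ ∂Q ≤ √(1 / c * ((InformationTheory.klDiv Q P).toReal + Real.log A)) := by
  have hsq : ∀ θ, g θ ^ 2 ∈ Set.Icc (0 : ℝ) 1 := fun θ =>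
    ⟨sq_nonneg _, by have := hg θ; nlinarith [this.1, this.2]⟩
  have hQ2 : Integrable (fun θ => g θ ^ 2) Q :=
    Integrable.of_mem_Icc 0 1 (by fun_prop) (ae_of_all _ hsq)
  have hQ1 : Integrable g Q := Integrable.of_mem_Icc (-1) 1 (by fun_prop) (ae_of_all _ hg)
  have hP : Integrable (fun θ => Real.exp (c * g θ ^ 2)) P := by
    refine Integrable.of_mem_Icc 0 (Real.exp c) (by fun_prop) (ae_of_all _ fun θ => ?_)
    exact ⟨(Real.exp_pos _).le, Real.exp_le_exp.2 (by nlinarith [(hsq θ).2])⟩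
  rw [← ofReal_integral_eq_lintegral_ofReal hP (ae_of_all _ fun θ => (Real.exp_pos _).le)] at hA
  have hpos : 0 < ∫ θ, Real.exp (c * g θ ^ 2) ∂P := integral_exp_pos hP
  have hA0 : ∫ θ, Real.exp (c * g θ ^ 2) ∂P ≤ A := by
    rcases ENNReal.ofReal_le_ofReal_iff'.1 hA with h | h
    · exact h
    · linarith
  have hDV := integral_le_klDiv_add_log_integral_exp (hQ2.const_mul c) hP hKL
  rw [integral_const_mul] at hDV
  have hlog := Real.log_le_log hpos hA0
  have hJ : (∫ θ, g θ ∂Q) ^ 2 ≤ ∫ θ, g θ ^ 2 ∂Q := by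
    have h0 : 0 ≤ ∫ θ, (g θ - ∫ θ, g θ ∂Q) ^ 2 ∂Q := integral_nonneg fun θ => sq_nonneg _
    have h1 : ∀ θ, (g θ - ∫ θ, g θ ∂Q) ^ 2 =
        g θ ^ 2 - (2 * ∫ θ, g θ ∂Q) * g θ + (∫ θ, g θ ∂Q) ^ 2 := fun θ => by ring
    simp_rw [h1] at h0
    rw [integral_add (f := fun θ => g θ ^ 2 - (2 * ∫ θ, g θ ∂Q) * g θ)
        (hQ2.sub (hQ1.const_mul _)) (integrable_const _),
      integral_sub hQ2 (hQ1.const_mul _), integral_const_mul, integral_const] at h0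
    simp at h0
    nlinarith
  refine Real.le_sqrt_of_sq_le (hJ.trans ?_)
  rw [one_div, inv_mul_eq_div, le_div_iff₀ hc]
  linarith

/-- Hoeffding's lemma in square-exponential form: the empirical mean of `s` independent samples of
a `[0, 1]`-valued function has variance proxy `1 / (4 s)`, so the exponent `2 s - 1` lies just below
the critical value `2 s`. -/
theorem lintegral_exp_sq_integral_sub_average_le {Z : Type*} [MeasurableSpace Z] (D : Measure Z)
    [IsProbabilityMeasure D] {h : Z → ℝ} (hm : Measurable h) (h01 : ∀ z, h z ∈ Set.Icc (0 : ℝ) 1)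
    {s : ℕ} (hs : 1 ≤ s) :
    ∫⁻ S, ENNReal.ofReal (Real.exp ((2 * (s : ℝ) - 1) *
      (∫ z, h z ∂D - 1 / (s : ℝ) * ∑ i, h (S i)) ^ 2)) ∂(Measure.pi fun _ : Fin s => D) ≤
      ENNReal.ofReal (4 * s) := by
  have hs1 : (1 : ℝ) ≤ s := by exact_mod_cast hs
  have hs0 : (s : ℝ) ≠ 0 := by positivity
  have hind : iIndepFun (fun (i : Fin s) (S : Fin s → Z) => h (S i) - ∫ z, h z ∂D)
      (Measure.pi fun _ : Fin s => D) :=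
    iIndepFun_pi (μ := fun _ : Fin s => D) (X := fun _ z => h z - ∫ z, h z ∂D)
      fun _ => (hm.sub_const _).aemeasurable
  have hsub : ∀ i : Fin s, HasSubgaussianMGF (fun S : Fin s → Z => h (S i) - ∫ z, h z ∂D)
      ((‖(1 : ℝ) - 0‖₊ / 2) ^ 2) (Measure.pi fun _ : Fin s => D) := by
    intro i
    have h1 := hasSubgaussianMGF_of_mem_Icc (μ := D) hm.aemeasurable (ae_of_all _ h01)
    have hmp := measurePreserving_eval (fun _ : Fin s => D) i
    rw [← hmp.map_eq] at h1
    have h2 := HasSubgaussianMGF.of_map hmp.measurable.aemeasurable h1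
    rw [hmp.map_eq] at h2
    exact h2
  have hsum := HasSubgaussianMGF.sum_of_iIndepFun hind (s := Finset.univ) fun i _ => hsub i
  have hc : ((∑ _i : Fin s, (‖(1 : ℝ) - 0‖₊ / 2) ^ 2 : NNReal) : ℝ) = s / 4 := by
    simp
    ring
  have h3 := lintegral_exp_mul_sq_le_of_hasSubgaussianMGF
    (a := (2 * (s : ℝ) - 1) / (s : ℝ) ^ 2) (by fun_prop) hsum
    (div_nonneg (by linarith) (by positivity)) (by rw [hc]; field_simp; linarith)
  rw [hc] at h3
  have h4 : √(1 / (1 - 2 * ((2 * (s : ℝ) - 1) / (s : ℝ) ^ 2) * (s / 4))) ≤ 4 * s := by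
    have : 1 / (1 - 2 * ((2 * (s : ℝ) - 1) / (s : ℝ) ^ 2) * (s / 4)) = 2 * s := by
      have : 1 - 2 * ((2 * (s : ℝ) - 1) / (s : ℝ) ^ 2) * (s / 4) = 1 / (2 * s) := by
        field_simp
        ring
      rw [this, one_div_one_div]
    rw [this]
    exact Real.sqrt_le_iff.2 ⟨by positivity, by nlinarith⟩
  refine (le_of_eq (lintegral_congr fun S => ?_)).trans (h3.trans (ENNReal.ofReal_le_ofReal h4))
  congr 2
  rw [Finset.sum_sub_distrib]
  simp only [Finset.sum_const, Finset.card_univ, Fintype.card_fin, nsmul_eq_mul]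
  field_simp
  ring

/-! ### Indistinguishable measures and their densities -/

/-- The privacy inequality leaves mass at most `2 δ / ε` to a set on which the likelihood ratio is
at least `exp (2 ε)`. -/
theorem le_of_le_exp_mul_add {ε δ m n : ℝ} (hε : 0 < ε) (hε2 : ε ≤ 1 / 2) (hm : 0 ≤ m)
    (h₁ : m ≤ Real.exp ε * n + δ) (h₂ : Real.exp (2 * ε) * n ≤ m) : m ≤ 2 * (δ / ε) := by
  have he : Real.exp (2 * ε) = Real.exp ε * Real.exp ε := by rw [← Real.exp_add]; congr 1; ring
  have h3 : 1 + ε ≤ Real.exp ε := by linarith [Real.add_one_le_exp ε]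
  have h4 : Real.exp ε * (m - δ) ≤ m := by
    rw [he] at h₂
    nlinarith [Real.exp_pos ε]
  have h5 : m - δ ≤ (1 - ε / 2) * m := by
    by_contra! h
    have h6 := mul_lt_mul_of_pos_left h (Real.exp_pos ε)
    have h7 : (1 + ε) * ((1 - ε / 2) * m) ≤ Real.exp ε * ((1 - ε / 2) * m) :=
      mul_le_mul_of_nonneg_right h3 (mul_nonneg (by linarith) hm)
    nlinarith [mul_nonneg hε.le hm, mul_nonneg (mul_nonneg hε.le hm) (sub_nonneg.2 hε2)]
  rw [← mul_div_assoc, le_div_iff₀ hε]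
  linarith

theorem sq_add_one_le_of_mem_exp_Icc {ε x : ℝ} (hε : 0 < ε) (hε2 : ε ≤ 1 / 2)
    (hl : Real.exp (-(2 * ε)) ≤ x) (hu : x ≤ Real.exp (2 * ε)) :
    x ^ 2 + 1 ≤ 2 * x + 16 * ε ^ 2 := by
  have h1 : 1 - 2 * ε ≤ x := by linarith [Real.add_one_le_exp (-(2 * ε))]
  have h2 : Real.exp (2 * ε) ≤ 1 + 4 * ε := by
    have h := Real.abs_exp_sub_one_sub_id_le (x := 2 * ε) (by rw [abs_le]; constructor <;> linarith)
    have := (abs_le.1 h).2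
    nlinarith
  have h3 : (x - 1) ^ 2 ≤ (4 * ε) ^ 2 := sq_le_sq' (by linarith) (by linarith)
  linarith

/-- For mutually `(ε, δ)`-indistinguishable `μ` and `ν`, the density of `μ` lies within a factor
`exp (2 ε)` of one off a set that is small for both measures; the part of `μ` singular to `ν` is
small as well. -/
theorem rnDeriv_mem_exp_Icc_off_small {Ω : Type*} [MeasurableSpace Ω] {μ ν : Measure Ω}
    [IsProbabilityMeasure μ] [IsProbabilityMeasure ν]
    {ε δ : ℝ} (hε : 0 < ε) (hε2 : ε ≤ 1 / 2) (hδ : 0 ≤ δ)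
    (hμν : ∀ E, MeasurableSet E → μ E ≤ ENNReal.ofReal (Real.exp ε) * ν E + ENNReal.ofReal δ)
    (hνμ : ∀ E, MeasurableSet E → ν E ≤ ENNReal.ofReal (Real.exp ε) * μ E + ENNReal.ofReal δ) :
    ∃ B, MeasurableSet B ∧
      (∀ x ∉ B, ENNReal.ofReal (Real.exp (-(2 * ε))) ≤ μ.rnDeriv ν x ∧
        μ.rnDeriv ν x ≤ ENNReal.ofReal (Real.exp (2 * ε))) ∧
      ν B ≤ ENNReal.ofReal (4 * (δ / ε)) ∧
      μ.singularPart ν Set.univ + ν.withDensity (μ.rnDeriv ν) B ≤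
        ENNReal.ofReal (4 * (δ / ε)) := by
  set r := μ.rnDeriv ν with hr
  have hrm : Measurable r := Measure.measurable_rnDeriv _ _
  set lam := ν.withDensity r with hlam
  set sg := μ.singularPart ν with hsg
  have hdec : ∀ E, μ E = sg E + lam E := fun E => by
    conv_lhs => rw [Measure.haveLebesgueDecomposition_add μ ν]
    rfl
  have hsing := Measure.mutuallySingular_singularPart μ ν
  set T := hsing.nullSet
  have hT : MeasurableSet T := hsing.measurableSet_nullSet
  have hsT : sg T = 0 := hsing.measure_nullSet
  have hνT : ν Tᶜ = 0 := hsing.measure_compl_nullSet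
  set B₁ : Set Ω := {x | ENNReal.ofReal (Real.exp (2 * ε)) < r x} with hB₁
  set B₂ : Set Ω := {x | r x < ENNReal.ofReal (Real.exp (-(2 * ε)))} with hB₂
  have hB₁m : MeasurableSet B₁ := measurableSet_lt measurable_const hrm
  have hB₂m : MeasurableSet B₂ := measurableSet_lt hrm measurable_const
  have hreal : ∀ (ρ₁ ρ₂ : Measure Ω) [IsFiniteMeasure ρ₁] [IsFiniteMeasure ρ₂] (E : Set Ω),
      ρ₁ E ≤ ENNReal.ofReal (Real.exp ε) * ρ₂ E + ENNReal.ofReal δ →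
      ρ₁.real E ≤ Real.exp ε * ρ₂.real E + δ := by
    intro ρ₁ ρ₂ _ _ E h
    have := ENNReal.toReal_mono (by finiteness) h
    rwa [ENNReal.toReal_add (by finiteness) (by finiteness), ENNReal.toReal_mul,
      ENNReal.toReal_ofReal (Real.exp_pos _).le, ENNReal.toReal_ofReal hδ] at this
  -- the set where the density is large, together with the support of the singular part
  have hbig : μ (Tᶜ ∪ B₁) ≤ ENNReal.ofReal (2 * (δ / ε)) ∧
      ν B₁ ≤ ENNReal.ofReal (2 * (δ / ε)) := by
    have h1 := hreal μ ν _ (hμν (Tᶜ ∪ B₁) (hT.compl.union hB₁m))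
    have h2 : ν (Tᶜ ∪ B₁) = ν B₁ :=
      le_antisymm ((measure_union_le _ _).trans (by rw [hνT, zero_add]))
        (measure_mono Set.subset_union_right)
    have h3 : ENNReal.ofReal (Real.exp (2 * ε)) * ν B₁ ≤ μ (Tᶜ ∪ B₁) := by
      calc _ = ∫⁻ _ in B₁, ENNReal.ofReal (Real.exp (2 * ε)) ∂ν := by rw [setLIntegral_const]
        _ ≤ ∫⁻ x in B₁, r x ∂ν := setLIntegral_mono hrm fun x hx => le_of_lt hx
        _ = lam B₁ := (withDensity_apply _ hB₁m).symm
        _ ≤ μ B₁ := by rw [hdec]; exact le_add_self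
        _ ≤ _ := measure_mono Set.subset_union_right
    have h4 : Real.exp (2 * ε) * ν.real B₁ ≤ μ.real (Tᶜ ∪ B₁) := by
      have := ENNReal.toReal_mono (by finiteness) h3
      rwa [ENNReal.toReal_mul, ENNReal.toReal_ofReal (Real.exp_pos _).le] at this
    rw [measureReal_def ν, h2, ← measureReal_def] at h1
    have h5 := le_of_le_exp_mul_add hε hε2 measureReal_nonneg h1 h4
    have h6 : μ (Tᶜ ∪ B₁) ≤ ENNReal.ofReal (2 * (δ / ε)) :=
      (ENNReal.le_ofReal_iff_toReal_le (by finiteness) (by positivity)).2 h5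
    refine ⟨h6, le_trans ?_ (h3.trans h6)⟩
    refine le_mul_of_one_le_left zero_le ?_
    rw [← ENNReal.ofReal_one]
    exact ENNReal.ofReal_le_ofReal (Real.one_le_exp (by positivity))
  -- the set where the density is small
  have hsmall : ν B₂ ≤ ENNReal.ofReal (2 * (δ / ε)) ∧ lam B₂ ≤ ENNReal.ofReal (2 * (δ / ε)) := by
    have h1 := hreal ν μ _ (hνμ (B₂ ∩ T) (hB₂m.inter hT))
    have h2 : ν (B₂ ∩ T) = ν B₂ := by
      refine measure_inter_conull ?_
      exact measure_mono_null (fun x hx => by simp_all) hνT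
    have h3 : μ (B₂ ∩ T) ≤ lam B₂ := by
      rw [hdec, measure_mono_null Set.inter_subset_right hsT, zero_add]
      exact measure_mono Set.inter_subset_left
    have h4 : lam B₂ ≤ ENNReal.ofReal (Real.exp (-(2 * ε))) * ν B₂ := by
      calc lam B₂ = ∫⁻ x in B₂, r x ∂ν := withDensity_apply _ hB₂m
        _ ≤ ∫⁻ _ in B₂, ENNReal.ofReal (Real.exp (-(2 * ε))) ∂ν :=
          setLIntegral_mono measurable_const fun x hx => le_of_lt hx
        _ = _ := by rw [setLIntegral_const]
    have h5 : μ.real (B₂ ∩ T) ≤ Real.exp (-(2 * ε)) * ν.real B₂ := by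
      have := ENNReal.toReal_mono (by finiteness) (h3.trans h4)
      rwa [ENNReal.toReal_mul, ENNReal.toReal_ofReal (Real.exp_pos _).le] at this
    rw [measureReal_def ν, h2, ← measureReal_def] at h1
    have h6 : Real.exp (2 * ε) * μ.real (B₂ ∩ T) ≤ ν.real B₂ := by
      calc _ ≤ Real.exp (2 * ε) * (Real.exp (-(2 * ε)) * ν.real B₂) := by gcongr
        _ = _ := by rw [← mul_assoc, ← Real.exp_add]; simp
    have h7 := le_of_le_exp_mul_add hε hε2 measureReal_nonneg h1 h6
    have h8 : ν B₂ ≤ ENNReal.ofReal (2 * (δ / ε)) :=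
      (ENNReal.le_ofReal_iff_toReal_le (by finiteness) (by positivity)).2 h7
    refine ⟨h8, h4.trans (le_trans ?_ h8)⟩
    refine mul_le_of_le_one_left zero_le ?_
    rw [← ENNReal.ofReal_one]
    exact ENNReal.ofReal_le_ofReal (Real.exp_le_one_iff.2 (by linarith))
  have h4 : ENNReal.ofReal (4 * (δ / ε)) =
      ENNReal.ofReal (2 * (δ / ε)) + ENNReal.ofReal (2 * (δ / ε)) := by
    rw [← ENNReal.ofReal_add (by positivity) (by positivity)]
    congr 1
    ring
  refine ⟨B₁ ∪ B₂, hB₁m.union hB₂m, fun x hx => ?_, ?_, ?_⟩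
  · simp only [Set.mem_union, not_or, hB₁, hB₂, Set.mem_ofPred_eq, not_lt] at hx
    exact ⟨hx.2, hx.1⟩
  · rw [h4]
    exact (measure_union_le _ _).trans (add_le_add hbig.2 hsmall.1)
  · have h5 : sg Set.univ ≤ sg (Tᶜ ∪ B₁) := by
      rw [← Set.union_compl_self T]
      refine (measure_union_le _ _).trans ?_
      rw [hsT, zero_add]
      exact measure_mono Set.subset_union_left
    calc sg Set.univ + lam (B₁ ∪ B₂) ≤ sg (Tᶜ ∪ B₁) + (lam (Tᶜ ∪ B₁) + lam B₂) := by
          refine add_le_add h5 ((measure_union_le _ _).trans ?_)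
          gcongr
          exact Set.subset_union_right
      _ = μ (Tᶜ ∪ B₁) + lam B₂ := by rw [hdec, add_assoc]
      _ ≤ _ := by
          rw [h4]
          exact add_le_add hbig.1 hsmall.2

/-- One coordinate at a time: if `μ` has first marginal `J` and is indistinguishable from
`J ⊗ D`, it dominates a measure with a density `r` that has almost the full mass and whose
conditional second moments exceed one only by `O(ε² + √(δ / ε))`. The gain over the pointwise
bound `exp (2 ε)`, which would only give `O(ε)`, comes from the conditional mean of `r` being at
most one. -/
theorem exists_subdensity_of_indistinguishable_prod {W Z : Type*} [MeasurableSpace W]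
    [MeasurableSpace Z] {J : Measure W} [IsProbabilityMeasure J]
    {D : Measure Z} [IsProbabilityMeasure D] {μ : Measure (W × Z)} [IsProbabilityMeasure μ]
    (hfst : μ.fst = J) {ε δ : ℝ} (hε : 0 < ε) (hε2 : ε ≤ 1 / 2) (hδ : 0 < δ) (hδε : δ < ε)
    (hμν : ∀ E, MeasurableSet E →
      μ E ≤ ENNReal.ofReal (Real.exp ε) * (J.prod D) E + ENNReal.ofReal δ)
    (hνμ : ∀ E, MeasurableSet E →
      (J.prod D) E ≤ ENNReal.ofReal (Real.exp ε) * μ E + ENNReal.ofReal δ) :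
    ∃ r : W × Z → ENNReal, Measurable r ∧ (J.prod D).withDensity r ≤ μ ∧
      (∀ w, ∫⁻ z, r (w, z) ∂D ≤ 1) ∧
      (∀ w, ∫⁻ z, r (w, z) ^ 2 ∂D ≤ ENNReal.ofReal (1 + 16 * ε ^ 2 + √(δ / ε))) ∧
      1 ≤ ∫⁻ p, r p ∂(J.prod D) + ENNReal.ofReal (8 * √(δ / ε)) := by
  set ν := J.prod D with hν
  obtain ⟨B, hB, hBr, hνB, hsB⟩ := rnDeriv_mem_exp_Icc_off_small hε hε2 hδ.le hμν hνμ
  set r := μ.rnDeriv ν with hr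
  have hrm : Measurable r := Measure.measurable_rnDeriv _ _
  have hle : ν.withDensity r ≤ μ := Measure.withDensity_rnDeriv_le μ ν
  have hηp : 0 < √(δ / ε) := Real.sqrt_pos.2 (by positivity)
  have hη2 : √(δ / ε) ^ 2 = δ / ε := Real.sq_sqrt (by positivity)
  have hη1 : √(δ / ε) ≤ 1 := Real.sqrt_le_one.2 ((div_le_one hε).2 hδε.le)
  set η := √(δ / ε)
  have hDB : Measurable fun w => D (Prod.mk w ⁻¹' B) := measurable_measure_prodMk_left hB
  have hIr : Measurable fun w => ∫⁻ z, r (w, z) ∂D := hrm.lintegral_prod_right'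
  set H : Set W := {w | ENNReal.ofReal η ≤ D (Prod.mk w ⁻¹' B)} with hH
  set L : Set W := {w | 1 < ∫⁻ z, r (w, z) ∂D} with hL
  have hHm : MeasurableSet H := measurableSet_le measurable_const hDB
  have hLm : MeasurableSet L := measurableSet_lt measurable_const hIr
  have hcyl : ∀ A, MeasurableSet A → ν.withDensity r (A ×ˢ Set.univ) ≤ J A := fun A hA => by
    refine (hle _).trans (le_of_eq ?_)
    rw [← hfst, Measure.fst_apply hA]
    congr 1
    ext p
    simp
  -- Markov's inequality: the mass `O(δ / ε) = O(η²)` of `B` leaves `O(η)` for heavy fibres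
  have hJH : J H ≤ ENNReal.ofReal (4 * η) := by
    have h1 := mul_meas_ge_le_lintegral (μ := J) hDB (ENNReal.ofReal η)
    rw [← Measure.prod_apply hB] at h1
    have h2 := h1.trans hνB
    rw [show 4 * (δ / ε) = η * (4 * η) by rw [← hη2]; ring, ENNReal.ofReal_mul hηp.le] at h2
    exact (ENNReal.mul_le_mul_iff_right (by simpa using hηp) (by finiteness)).1 h2
  -- the marginal of `μ` on `W` is `J`, so the conditional mean of `r` is at most one
  have hJL : J L = 0 := by
    have h1 : (fun w => ∫⁻ z, r (w, z) ∂D) ≤ᵐ[J] fun _ => 1 := by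
      refine ae_le_of_forall_setLIntegral_le_of_sigmaFinite hIr fun A hA _ => ?_
      rw [setLIntegral_one]
      refine le_trans (le_of_eq ?_) (hcyl A hA)
      rw [withDensity_apply _ (hA.prod MeasurableSet.univ), hν, ← Measure.prod_restrict,
        lintegral_prod _ hrm.aemeasurable, Measure.restrict_univ]
    rw [← nonpos_iff_eq_zero]
    refine (measure_mono fun w hw => ?_).trans_eq h1
    exact not_le.2 (show 1 < ∫⁻ z, r (w, z) ∂D from hw)
  set G : Set (W × Z) := ((H ∪ L) ×ˢ Set.univ ∪ B)ᶜ with hG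
  have hGm : MeasurableSet G := (((hHm.union hLm).prod MeasurableSet.univ).union hB).compl
  have hGr : ∀ p, G.indicator r p ≤ r p := Set.indicator_le_self G r
  have hfib : ∀ w, (∃ z, (w, z) ∈ G) → w ∉ H ∧ w ∉ L := by
    rintro w ⟨z, hz⟩
    simp only [hG, Set.mem_compl_iff, Set.mem_union, Set.mem_prod, Set.mem_univ, and_true,
      not_or] at hz
    exact hz.1
  have hzero : ∀ w, (¬ ∃ z, (w, z) ∈ G) → ∀ z, G.indicator r (w, z) = 0 := fun w hw z =>
    Set.indicator_of_notMem (fun h => hw ⟨z, h⟩) _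
  have hmean : ∀ w, ∫⁻ z, G.indicator r (w, z) ∂D ≤ 1 := by
    intro w
    by_cases hw : ∃ z, (w, z) ∈ G
    · exact (lintegral_mono fun z => hGr _).trans (not_lt.1 (hfib w hw).2)
    · simp [hzero w hw]
  refine ⟨G.indicator r, hrm.indicator hGm, ?_, hmean, fun w => ?_, ?_⟩
  · exact (withDensity_mono (ae_of_all _ hGr)).trans hle
  · by_cases hw : ∃ z, (w, z) ∈ G
    swap
    · simp [hzero w hw]
    -- pointwise `r² + 1 ≤ 2 r + 16 ε²` on `G`, whose fibre has probability at least `1 - η`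
    have hpt : ∀ z, G.indicator r (w, z) ^ 2 + 1 ≤
        2 * G.indicator r (w, z) + ENNReal.ofReal (16 * ε ^ 2) +
          (Prod.mk w ⁻¹' B).indicator 1 z := by
      intro z
      by_cases hzB : (w, z) ∈ B
      · have h1 : (w, z) ∉ G := fun h => h (Or.inr hzB)
        have h2 : z ∈ Prod.mk w ⁻¹' B := hzB
        simp [Set.indicator_of_notMem h1, Set.indicator_of_mem h2]
      · have h1 : (w, z) ∈ G := by
          simp only [hG, Set.mem_compl_iff, Set.mem_union, Set.mem_prod, Set.mem_univ, and_true,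
            not_or]
          exact ⟨hfib w hw, hzB⟩
        rw [Set.indicator_of_mem h1]
        refine le_add_right ?_
        obtain ⟨hl, hu⟩ := hBr _ hzB
        have hfin : r (w, z) ≠ ⊤ := ne_top_of_le_ne_top ENNReal.ofReal_ne_top hu
        obtain ⟨x, hx⟩ : ∃ x : ℝ, x = (r (w, z)).toReal := ⟨_, rfl⟩
        have hrx : r (w, z) = ENNReal.ofReal x := by rw [hx, ENNReal.ofReal_toReal hfin]
        have hx0 : 0 ≤ x := hx ▸ ENNReal.toReal_nonneg
        rw [hrx] at hl hu ⊢
        have h3 := sq_add_one_le_of_mem_exp_Icc hε hε2 ((ENNReal.ofReal_le_ofReal_iff hx0).1 hl)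
          ((ENNReal.ofReal_le_ofReal_iff (Real.exp_pos _).le).1 hu)
        have h4 := ENNReal.ofReal_le_ofReal h3
        rwa [ENNReal.ofReal_add (by positivity) (by positivity),
          ENNReal.ofReal_add (by positivity) (by positivity), ENNReal.ofReal_pow hx0,
          ENNReal.ofReal_mul (by positivity), ENNReal.ofReal_one, ENNReal.ofReal_ofNat] at h4
    have hGw : Measurable fun z => G.indicator r (w, z) :=
      (hrm.indicator hGm).comp measurable_prodMk_left
    have hBw : MeasurableSet (Prod.mk w ⁻¹' B) := measurable_prodMk_left hB
    have h5 := lintegral_mono (μ := D) hpt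
    rw [lintegral_add_right _ measurable_const, lintegral_add_right _ (by
      exact measurable_one.indicator hBw), lintegral_add_right _ measurable_const,
      lintegral_const_mul _ hGw, lintegral_indicator_one hBw] at h5
    simp only [lintegral_const, measure_univ, mul_one] at h5
    have h6 : D (Prod.mk w ⁻¹' B) ≤ ENNReal.ofReal η := (not_le.1 (hfib w hw).1).le
    have h7 : ∫⁻ z, G.indicator r (w, z) ^ 2 ∂D + 1 ≤
        ENNReal.ofReal (1 + 16 * ε ^ 2 + η) + 1 := by
      refine h5.trans ?_
      calc _ ≤ 2 * 1 + ENNReal.ofReal (16 * ε ^ 2) + ENNReal.ofReal η := by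
            gcongr
            exact hmean w
        _ = _ := by
            rw [ENNReal.ofReal_add (by positivity) hηp.le,
              ENNReal.ofReal_add zero_le_one (by positivity), ENNReal.ofReal_one, mul_one,
              ← one_add_one_eq_two]
            ring
    exact (ENNReal.add_le_add_iff_right ENNReal.one_ne_top).1 h7
  · rw [lintegral_indicator hGm, ← withDensity_apply _ hGm]
    set lam := ν.withDensity r
    have hone : (1 : ENNReal) = μ.singularPart ν Set.univ + lam Set.univ := by
      rw [← measure_univ (μ := μ)]
      conv_lhs => rw [Measure.haveLebesgueDecomposition_add μ ν]
      rfl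
    have hcov : lam Set.univ ≤ lam G + (lam (H ×ˢ Set.univ) + lam (L ×ˢ Set.univ) + lam B) := by
      rw [← Set.union_compl_self G, hG, compl_compl]
      refine (measure_union_le _ _).trans (add_le_add le_rfl ?_)
      refine (measure_union_le _ _).trans (add_le_add ?_ le_rfl)
      rw [Set.union_prod]
      exact measure_union_le _ _
    calc (1 : ENNReal) = μ.singularPart ν Set.univ + lam Set.univ := hone
      _ ≤ μ.singularPart ν Set.univ +
          (lam G + (lam (H ×ˢ Set.univ) + lam (L ×ˢ Set.univ) + lam B)) := by gcongr
      _ = lam G + (lam (H ×ˢ Set.univ) + lam (L ×ˢ Set.univ) +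
          (μ.singularPart ν Set.univ + lam B)) := by ring
      _ ≤ lam G + (ENNReal.ofReal (4 * η) + 0 + ENNReal.ofReal (4 * (δ / ε))) := by
          gcongr
          · exact (hcyl H hHm).trans hJH
          · exact (hcyl L hLm).trans hJL.le
      _ ≤ lam G + ENNReal.ofReal (8 * η) := by
          rw [add_zero, ← ENNReal.ofReal_add (by positivity) (by positivity), ← hη2]
          gcongr
          nlinarith

/-! ### Tensorization over the data points -/

/-- Integration against a law `J` that dominates `ρ ν` and has at most `b` mass besides. -/
theorem lintegral_le_of_withDensity_le {Ω : Type*} [MeasurableSpace Ω] {J ν : Measure Ω}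
    [IsProbabilityMeasure J] {ρ g : Ω → ENNReal} {b C : ENNReal} (hρ : Measurable ρ)
    (hle : ν.withDensity ρ ≤ J) (hmass : 1 ≤ ∫⁻ ω, ρ ω ∂ν + b) (hg : Measurable g)
    (hgC : ∀ ω, g ω ≤ C) : ∫⁻ ω, g ω ∂J ≤ ∫⁻ ω, ρ ω * g ω ∂ν + C * b := by
  have hfin : IsFiniteMeasure (ν.withDensity ρ) := isFiniteMeasure_of_le J hle
  have hdec : J - ν.withDensity ρ + ν.withDensity ρ = J := Measure.sub_add_cancel_of_le hle
  have huniv : ∫⁻ ω, ρ ω ∂ν = ν.withDensity ρ Set.univ := by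
    rw [withDensity_apply _ MeasurableSet.univ, Measure.restrict_univ]
  have hdef : (J - ν.withDensity ρ) Set.univ ≤ b := by
    have h1 : (J - ν.withDensity ρ) Set.univ + ν.withDensity ρ Set.univ = 1 := by
      rw [← Measure.add_apply, hdec, measure_univ]
    rw [huniv, ← h1, add_comm _ b] at hmass
    exact (ENNReal.add_le_add_iff_right (measure_ne_top _ _)).1 hmass
  calc ∫⁻ ω, g ω ∂J = ∫⁻ ω, g ω ∂(J - ν.withDensity ρ) + ∫⁻ ω, g ω ∂(ν.withDensity ρ) := by
        rw [← lintegral_add_measure, hdec]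
    _ ≤ C * b + ∫⁻ ω, ρ ω * g ω ∂ν := by
        refine add_le_add ?_ (le_of_eq ?_)
        · calc _ ≤ ∫⁻ _, C ∂(J - ν.withDensity ρ) := lintegral_mono hgC
            _ ≤ C * b := by rw [lintegral_const]; gcongr
        · rw [lintegral_withDensity_eq_lintegral_mul _ hρ hg]
          rfl
    _ = _ := add_comm _ _

theorem lintegral_le_const_mul_lintegral_add {Ω : Type*} [MeasurableSpace Ω] {μ : Measure Ω}
    [IsProbabilityMeasure μ] {f g : Ω → ENNReal} {c d : ENNReal} (hg : Measurable g)
    (h : ∀ ω, f ω ≤ c * g ω + d) : ∫⁻ ω, f ω ∂μ ≤ c * ∫⁻ ω, g ω ∂μ + d := by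
  refine (lintegral_mono h).trans (le_of_eq ?_)
  rw [lintegral_add_right _ measurable_const, lintegral_const_mul _ hg, lintegral_const,
    measure_univ, mul_one]

theorem adjacentData_cons {Z : Type*} {s : ℕ} (w : Fin s → Z) (z z' : Z) :
    AdjacentData (Fin.cons z w : Fin (s + 1) → Z) (Fin.cons z' w) :=
  ⟨0, fun j hj => by obtain ⟨i, rfl⟩ := Fin.exists_succ_eq.2 hj; simp⟩

section Tensorization

variable {Z Θ : Type*} [MeasurableSpace Z] [MeasurableSpace Θ]

theorem measurable_fin_cons (s : ℕ) :
    Measurable fun p : (Fin s → Z) × Z => (Fin.cons p.2 p.1 : Fin (s + 1) → Z) := by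
  refine measurable_pi_lambda _ fun i => ?_
  refine Fin.cases ?_ (fun j => ?_) i
  · simpa using measurable_snd
  · simp only [Fin.cons_succ]
    fun_prop

theorem measurePreserving_fin_cons (D : Measure Z) [IsProbabilityMeasure D] (s : ℕ) :
    MeasurePreserving (fun p : (Fin s → Z) × Z => (Fin.cons p.2 p.1 : Fin (s + 1) → Z))
      ((Measure.pi fun _ : Fin s => D).prod D) (Measure.pi fun _ : Fin (s + 1) => D) := by
  have h := ((measurePreserving_piFinSuccAbove (fun _ : Fin (s + 1) => D) 0).symm).comp
    (Measure.measurePreserving_swap (μ := Measure.pi fun _ : Fin s => D) (ν := D))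
  convert h using 1
  ext p i
  simp [MeasurableEquiv.piFinSuccAbove, Fin.insertNthEquiv]

/-- The algorithm that is run on a data set with its first entry redrawn from `D`. -/
noncomputable def averageFirst (D : Measure Z) {s : ℕ} (P : Kernel (Fin (s + 1) → Z) Θ) :
    Kernel (Fin s → Z) Θ :=
  Kernel.snd (Kernel.const _ D ⊗ₖ
    P.comap (fun p : (Fin s → Z) × Z => (Fin.cons p.2 p.1 : Fin (s + 1) → Z))
      (measurable_fin_cons s))

instance (D : Measure Z) [IsProbabilityMeasure D] {s : ℕ} (P : Kernel (Fin (s + 1) → Z) Θ)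
    [IsMarkovKernel P] : IsMarkovKernel (averageFirst D P) := by
  unfold averageFirst
  infer_instance

theorem averageFirst_apply (D : Measure Z) [IsProbabilityMeasure D] {s : ℕ}
    (P : Kernel (Fin (s + 1) → Z) Θ) [IsMarkovKernel P] (w : Fin s → Z) {E : Set Θ}
    (hE : MeasurableSet E) : averageFirst D P w E = ∫⁻ z, P (Fin.cons z w) E ∂D := by
  rw [averageFirst, Kernel.snd_apply' _ _ hE, Kernel.compProd_apply (measurable_snd hE)]
  simp only [Kernel.const_apply, Kernel.comap_apply]
  rfl

/-- Privacy in the remaining entries survives the averaging, because the privacy inequality is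
linear in the output laws. -/
theorem IsDP.averageFirst {D : Measure Z} [IsProbabilityMeasure D] {s : ℕ}
    {P : Kernel (Fin (s + 1) → Z) Θ} [IsMarkovKernel P] {ε δ : ℝ} (hP : IsDP P ε δ) :
    IsDP (averageFirst D P) ε δ := by
  rintro w₁ w₂ ⟨i, hi⟩ E hE
  have hm : ∀ w : Fin s → Z, Measurable fun z => P (Fin.cons z w) E := fun w =>
    (P.measurable_coe hE).comp ((measurable_fin_cons s).comp measurable_prodMk_left)
  rw [averageFirst_apply D P _ hE, averageFirst_apply D P _ hE]
  refine lintegral_le_const_mul_lintegral_add (hm w₂) fun z => hP _ _ ⟨i.succ, fun j => ?_⟩ E hE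
  refine Fin.cases (fun _ => ?_) (fun j hj => ?_) j
  · simp
  · simpa using hi j fun h => hj (by rw [h])

/-- The joint law of a data set and the output, with the first data point set apart. -/
noncomputable def jointSplit (D : Measure Z) {s : ℕ} (P : Kernel (Fin (s + 1) → Z) Θ) :
    Measure (((Fin s → Z) × Θ) × Z) :=
  (((Measure.pi fun _ : Fin s => D).prod D) ⊗ₘ
    P.comap (fun p : (Fin s → Z) × Z => (Fin.cons p.2 p.1 : Fin (s + 1) → Z))
      (measurable_fin_cons s)).map fun q => ((q.1.1, q.2), q.1.2)

variable (D : Measure Z) [IsProbabilityMeasure D] {s : ℕ} (P : Kernel (Fin (s + 1) → Z) Θ)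
  [IsMarkovKernel P]

instance : IsProbabilityMeasure (jointSplit D P) :=
  Measure.isProbabilityMeasure_map (by fun_prop)

theorem jointSplit_apply {E : Set (((Fin s → Z) × Θ) × Z)} (hE : MeasurableSet E) :
    jointSplit D P E = ∫⁻ w, ∫⁻ z, P (Fin.cons z w) {θ | ((w, θ), z) ∈ E} ∂D
      ∂(Measure.pi fun _ : Fin s => D) := by
  have hF : MeasurableSet
      ((fun q : ((Fin s → Z) × Z) × Θ => ((q.1.1, q.2), q.1.2)) ⁻¹' E) :=
    (by fun_prop : Measurable fun q : ((Fin s → Z) × Z) × Θ => ((q.1.1, q.2), q.1.2)) hE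
  rw [jointSplit, Measure.map_apply (by fun_prop) hE, Measure.compProd_apply hF,
    lintegral_prod _ (Kernel.measurable_kernel_prodMk_left hF).aemeasurable]
  rfl

/-- The other data points and the output have the law they would have had with the first data
point redrawn. -/
theorem fst_jointSplit :
    (jointSplit D P).fst = (Measure.pi fun _ : Fin s => D) ⊗ₘ averageFirst D P := by
  ext A hA
  rw [Measure.fst_apply hA, jointSplit_apply D P (measurable_fst hA), Measure.compProd_apply hA]
  refine lintegral_congr fun w => ?_
  rw [averageFirst_apply D P _ (measurable_prodMk_left hA)]
  rfl

theorem prod_averageFirst_apply {E : Set (((Fin s → Z) × Θ) × Z)} (hE : MeasurableSet E) :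
    (((Measure.pi fun _ : Fin s => D) ⊗ₘ averageFirst D P).prod D) E =
      ∫⁻ w, ∫⁻ z, ∫⁻ z', P (Fin.cons z' w) {θ | ((w, θ), z) ∈ E} ∂D ∂D
        ∂(Measure.pi fun _ : Fin s => D) := by
  have hsec : ∀ z, MeasurableSet ((fun p : (Fin s → Z) × Θ => (p, z)) ⁻¹' E) := fun z =>
    measurable_prodMk_right hE
  have hF : MeasurableSet
      ((fun q : ((Fin s → Z) × Z) × Θ => ((q.1.1, q.2), q.1.2)) ⁻¹' E) :=
    (by fun_prop : Measurable fun q : ((Fin s → Z) × Z) × Θ => ((q.1.1, q.2), q.1.2)) hE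
  rw [Measure.prod_apply_symm hE]
  simp_rw [Measure.compProd_apply (hsec _)]
  rw [lintegral_lintegral_swap]
  · refine lintegral_congr fun w => lintegral_congr fun z => ?_
    rw [averageFirst_apply D P _ (measurable_prodMk_left (hsec z))]
    rfl
  · exact ((Kernel.measurable_kernel_prodMk_left
      (κ := (averageFirst D P).comap (Prod.fst : (Fin s → Z) × Z → _) measurable_fst) hF).comp
      measurable_swap).aemeasurable

variable {P}

theorem measurable_apply_section {E : Set (((Fin s → Z) × Θ) × Z)} (hE : MeasurableSet E) :
    Measurable fun q : ((Fin s → Z) × Z) × Z =>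
      P (Fin.cons q.2 q.1.1) {θ | ((q.1.1, θ), q.1.2) ∈ E} := by
  have hF : MeasurableSet
      ((fun q : (((Fin s → Z) × Z) × Z) × Θ => ((q.1.1.1, q.2), q.1.1.2)) ⁻¹' E) :=
    (by fun_prop : Measurable fun q : (((Fin s → Z) × Z) × Z) × Θ =>
      ((q.1.1.1, q.2), q.1.1.2)) hE
  exact Kernel.measurable_kernel_prodMk_left (κ := P.comap
    (fun q : ((Fin s → Z) × Z) × Z => (Fin.cons q.2 q.1.1 : Fin (s + 1) → Z))
    ((measurable_fin_cons s).comp (by fun_prop : Measurable fun q : ((Fin s → Z) × Z) × Z =>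
      (q.1.1, q.2)))) hF

/-- Privacy in the first entry: the true joint law is close to the one in which the first data
point is replaced, after the output has been drawn, by an independent copy. -/
theorem jointSplit_le_of_isDP {ε δ : ℝ} (hP : IsDP P ε δ)
    {E : Set (((Fin s → Z) × Θ) × Z)} (hE : MeasurableSet E) :
    jointSplit D P E ≤ ENNReal.ofReal (Real.exp ε) *
      (((Measure.pi fun _ : Fin s => D) ⊗ₘ averageFirst D P).prod D) E + ENNReal.ofReal δ := by
  have hm := measurable_apply_section (P := P) hE
  have hm1 := hm.lintegral_prod_right' (ν := D)
  rw [jointSplit_apply D P hE, prod_averageFirst_apply D P hE]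
  refine lintegral_le_const_mul_lintegral_add hm1.lintegral_prod_right' fun w =>
    lintegral_le_const_mul_lintegral_add (hm1.comp (measurable_prodMk_left (x := w))) fun z => ?_
  have h := lintegral_le_const_mul_lintegral_add (μ := D)
    (hm.comp (measurable_prodMk_left (x := (w, z)))) fun z' =>
      hP _ _ (adjacentData_cons w z z') _
        ((by fun_prop : Measurable fun θ : Θ => ((w, θ), z)) hE)
  simpa using h

/-- The converse comparison to `jointSplit_le_of_isDP`. -/
theorem prod_le_jointSplit_of_isDP {ε δ : ℝ} (hP : IsDP P ε δ)
    {E : Set (((Fin s → Z) × Θ) × Z)} (hE : MeasurableSet E) :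
    (((Measure.pi fun _ : Fin s => D) ⊗ₘ averageFirst D P).prod D) E ≤
      ENNReal.ofReal (Real.exp ε) * jointSplit D P E + ENNReal.ofReal δ := by
  have hm : Measurable fun p : (Fin s → Z) × Z =>
      P (Fin.cons p.2 p.1) {θ | ((p.1, θ), p.2) ∈ E} :=
    (measurable_apply_section (P := P) hE).comp (by fun_prop :
      Measurable fun p : (Fin s → Z) × Z => (p, p.2))
  rw [jointSplit_apply D P hE, prod_averageFirst_apply D P hE]
  refine lintegral_le_const_mul_lintegral_add hm.lintegral_prod_right' fun w =>
    lintegral_le_const_mul_lintegral_add (hm.comp (measurable_prodMk_left (x := w))) fun z => ?_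
  have h := lintegral_mono (μ := D) fun z' => hP _ _ (adjacentData_cons w z' z) _
    ((by fun_prop : Measurable fun θ : Θ => ((w, θ), z)) hE)
  rwa [lintegral_const, measure_univ, mul_one] at h

theorem measurable_cons_output :
    Measurable fun q : ((Fin s → Z) × Θ) × Z =>
      ((Fin.cons q.2 q.1.1 : Fin (s + 1) → Z), q.1.2) :=
  ((measurable_fin_cons s).comp (by fun_prop :
    Measurable fun q : ((Fin s → Z) × Θ) × Z => (q.1.1, q.2))).prodMk (by fun_prop)

theorem map_jointSplit :
    (jointSplit D P).map (fun q => ((Fin.cons q.2 q.1.1 : Fin (s + 1) → Z), q.1.2)) =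
      (Measure.pi fun _ : Fin (s + 1) => D) ⊗ₘ P := by
  ext E hE
  have hm := Kernel.measurable_kernel_prodMk_left (κ := P) hE
  rw [Measure.map_apply measurable_cons_output hE,
    jointSplit_apply D P (measurable_cons_output hE), Measure.compProd_apply hE,
    ← (measurePreserving_fin_cons D s).lintegral_comp hm,
    lintegral_prod (fun p : (Fin s → Z) × Z => P (Fin.cons p.2 p.1)
      (Prod.mk (Fin.cons p.2 p.1 : Fin (s + 1) → Z) ⁻¹' E))
      (hm.comp (measurable_fin_cons s)).aemeasurable]
  rfl

theorem map_prod_prod (M : Measure Θ) [IsProbabilityMeasure M] :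
    (((Measure.pi fun _ : Fin s => D).prod M).prod D).map
        (fun q => ((Fin.cons q.2 q.1.1 : Fin (s + 1) → Z), q.1.2)) =
      (Measure.pi fun _ : Fin (s + 1) => D).prod M := by
  ext E hE
  have hm := measurable_measure_prodMk_left (ν := M) hE
  have hE' := measurable_cons_output hE
  rw [Measure.map_apply measurable_cons_output hE, Measure.prod_apply_symm hE',
    Measure.prod_apply hE, ← (measurePreserving_fin_cons D s).lintegral_comp hm,
    lintegral_prod_symm (fun p : (Fin s → Z) × Z =>
      M (Prod.mk (Fin.cons p.2 p.1 : Fin (s + 1) → Z) ⁻¹' E))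
      (hm.comp (measurable_fin_cons s)).aemeasurable]
  refine lintegral_congr fun z => ?_
  rw [Measure.prod_apply (measurable_prodMk_right hE')]
  rfl


/-- A differentially private algorithm admits a data-independent prior `M` such that the joint
law of data and output has, up to a small mass, a density with respect to `Dˢ ⊗ M` whose second
moment grows only like `exp (s · O(ε² + √(δ / ε)))`. -/
theorem exists_subdensity_of_isDP {ε δ : ℝ} (hε : 0 < ε) (hε2 : ε ≤ 1 / 2) (hδ : 0 < δ)
    (hδε : δ < ε) : ∀ (s : ℕ) (P : Kernel (Fin s → Z) Θ) [IsMarkovKernel P], IsDP P ε δ →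
    ∃ M : Measure Θ, IsProbabilityMeasure M ∧ ∃ ρ : (Fin s → Z) × Θ → ENNReal, Measurable ρ ∧
      ((Measure.pi fun _ : Fin s => D).prod M).withDensity ρ ≤
        (Measure.pi fun _ : Fin s => D) ⊗ₘ P ∧
      ∫⁻ p, ρ p ^ 2 ∂((Measure.pi fun _ : Fin s => D).prod M) ≤
        ENNReal.ofReal (1 + 16 * ε ^ 2 + √(δ / ε)) ^ s ∧
      1 ≤ ∫⁻ p, ρ p ∂((Measure.pi fun _ : Fin s => D).prod M) +
        s * ENNReal.ofReal (8 * √(δ / ε)) := by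
  intro s
  induction s with
  | zero =>
    intro P _ _
    have hconst : P = Kernel.const _ (P default) := by
      ext S : 1
      rw [Subsingleton.elim S default, Kernel.const_apply]
    refine ⟨P default, inferInstance, fun _ => 1, measurable_const, ?_, ?_, ?_⟩
    · conv_rhs => rw [hconst, Measure.compProd_const]
      exact (withDensity_one).le
    · simp
    · simp
  | succ s ih =>
    intro P _ hP
    obtain ⟨M, hM, ρ, hρm, hρle, hρ2, hρ1⟩ := ih (averageFirst D P) hP.averageFirst
    obtain ⟨r, hrm, hrle, hr1, hr2, hrmass⟩ := exists_subdensity_of_indistinguishable_prod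
      (fst_jointSplit D P) hε hε2 hδ hδε (fun E hE => jointSplit_le_of_isDP D hP hE)
      (fun E hE => prod_le_jointSplit_of_isDP D hP hE)
    set μ := Measure.pi fun _ : Fin s => D with hμ
    set J := μ ⊗ₘ averageFirst D P with hJ
    have hρm' : Measurable fun q : ((Fin s → Z) × Θ) × Z => ρ q.1 := hρm.comp measurable_fst
    have hIr : Measurable fun w => ∫⁻ z, r (w, z) ∂D := hrm.lintegral_prod_right'
    have hΦ : Measurable fun p : (Fin (s + 1) → Z) × Θ => ((Fin.tail p.1, p.2), p.1 0) := by
      unfold Fin.tail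
      fun_prop
    set τ : ((Fin s → Z) × Θ) × Z → ENNReal := fun q => ρ q.1 * r q with hτ
    have hτm : Measurable τ := hρm'.mul hrm
    have hnew : Measurable fun p : (Fin (s + 1) → Z) × Θ =>
        τ ((Fin.tail p.1, p.2), p.1 0) := hτm.comp hΦ
    -- `ρ (μ ⊗ M) ≤ J` and `r (J ⊗ D) ≤ jointSplit` compose to a density `ρ r`
    have hsub : ((μ.prod M).prod D).withDensity τ ≤ jointSplit D P := by
      refine le_trans (Measure.le_iff.2 fun E hE => ?_) hrle
      have h1 : ((μ.prod M).prod D).withDensity (fun q => ρ q.1) ≤ J.prod D := by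
        rw [← prod_withDensity_left hρm]
        exact Measure.prod_mono hρle le_rfl
      have h2 := withDensity_mul ((μ.prod M).prod D) hρm' hrm
      rw [show τ = (fun q => ρ q.1) * r from rfl, h2, withDensity_apply _ hE,
        withDensity_apply _ hE]
      exact lintegral_mono' (Measure.restrict_mono le_rfl h1) le_rfl
    refine ⟨M, hM, fun p => τ ((Fin.tail p.1, p.2), p.1 0), hnew, ?_, ?_, ?_⟩
    · rw [← map_prod_prod D M, ← map_jointSplit D]
      refine Measure.le_iff.2 fun E hE => ?_
      rw [withDensity_apply _ hE, setLIntegral_map hE hnew measurable_cons_output,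
        Measure.map_apply measurable_cons_output hE]
      simp only [Fin.tail_cons, Fin.cons_zero]
      rw [← withDensity_apply _ (measurable_cons_output hE)]
      exact hsub _
    · rw [← map_prod_prod D M, lintegral_map (hnew.pow_const 2) measurable_cons_output]
      simp only [Fin.tail_cons, Fin.cons_zero]
      rw [lintegral_prod _ (hτm.pow_const 2).aemeasurable, pow_succ]
      calc _ ≤ ∫⁻ w, ρ w ^ 2 * ENNReal.ofReal (1 + 16 * ε ^ 2 + √(δ / ε)) ∂(μ.prod M) := by
            refine lintegral_mono fun w => ?_
            simp only [hτ, mul_pow]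
            rw [lintegral_const_mul _ (f := fun z => r (w, z) ^ 2)
              ((hrm.comp measurable_prodMk_left).pow_const 2)]
            gcongr
            exact hr2 w
        _ ≤ _ := by
            rw [lintegral_mul_const _ (hρm.pow_const 2)]
            gcongr
    · rw [← map_prod_prod D M, lintegral_map hnew measurable_cons_output]
      simp only [Fin.tail_cons, Fin.cons_zero]
      have h1 := lintegral_le_of_withDensity_le hρm hρle hρ1 hIr hr1
      rw [lintegral_prod _ hrm.aemeasurable] at hrmass
      have h2 : ∫⁻ q, τ q ∂((μ.prod M).prod D) =
          ∫⁻ w, ρ w * ∫⁻ z, r (w, z) ∂D ∂(μ.prod M) := by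
        rw [lintegral_prod _ hτm.aemeasurable]
        refine lintegral_congr fun w => ?_
        simp only [hτ]
        rw [lintegral_const_mul _ (f := fun z => r (w, z)) (hrm.comp measurable_prodMk_left)]
      rw [h2]
      refine hrmass.trans ((add_le_add h1 le_rfl).trans (le_of_eq ?_))
      push_cast
      ring

end Tensorization

/-! ### Generalization under a private choice of the parameter -/

/-- Change of measure under a bound on the second moment of the density: where `ρ ≤ exp k` the
density costs a factor `exp k`, and elsewhere `ρ ≤ exp (-k) ρ²`. -/
theorem lintegral_mul_le_exp_mul_lintegral_add {Ω : Type*} [MeasurableSpace Ω] {ν : Measure Ω}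
    {ρ f : Ω → ENNReal} {F : ENNReal} (hρ : Measurable ρ) (hf : Measurable f)
    (hfF : ∀ ω, f ω ≤ F) (k : ℝ) :
    ∫⁻ ω, ρ ω * f ω ∂ν ≤ ENNReal.ofReal (Real.exp k) * ∫⁻ ω, f ω ∂ν +
      F * (ENNReal.ofReal (Real.exp (-k)) * ∫⁻ ω, ρ ω ^ 2 ∂ν) := by
  rw [← lintegral_const_mul _ hf, ← lintegral_const_mul _ (hρ.pow_const 2),
    ← lintegral_const_mul _ ((hρ.pow_const 2).const_mul _),
    ← lintegral_add_left (hf.const_mul _)]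
  refine lintegral_mono fun ω => ?_
  rcases le_total (ρ ω) (ENNReal.ofReal (Real.exp k)) with h | h
  · exact le_add_right (mul_le_mul_left h _)
  · refine le_add_left ?_
    have h1 : ENNReal.ofReal (Real.exp (-k)) * ENNReal.ofReal (Real.exp k) = 1 := by
      rw [← ENNReal.ofReal_mul (Real.exp_pos _).le, ← Real.exp_add]
      simp
    calc ρ ω * f ω
        = f ω * (ENNReal.ofReal (Real.exp (-k)) * ENNReal.ofReal (Real.exp k) * ρ ω) := by
          rw [h1, one_mul, mul_comm]
      _ ≤ F * (ENNReal.ofReal (Real.exp (-k)) * ρ ω * ρ ω) := by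
          gcongr
          exact hfF ω
      _ = _ := by ring

/-- A bounded statistic with mean at most `a` for every fixed parameter keeps, under a
differentially private choice of the parameter, a mean of at most `a exp (s · O(ε² + √(δ / ε)))`,
up to the privacy slack. -/
theorem lintegral_compProd_le_of_isDP {Z Θ : Type*} [MeasurableSpace Z] [MeasurableSpace Θ]
    (D : Measure Z) [IsProbabilityMeasure D] {ε δ : ℝ} (hε : 0 < ε) (hε2 : ε ≤ 1 / 2)
    (hδ : 0 < δ) (hδε : δ < ε) {s : ℕ} (P : Kernel (Fin s → Z) Θ) [IsMarkovKernel P]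
    (hP : IsDP P ε δ) {f : (Fin s → Z) × Θ → ENNReal} (hf : Measurable f) {a F : ℝ}
    (ha : 0 ≤ a) (hF : 0 ≤ F) (hfF : ∀ p, f p ≤ ENNReal.ofReal F)
    (hfa : ∀ θ, ∫⁻ S, f (S, θ) ∂(Measure.pi fun _ : Fin s => D) ≤ ENNReal.ofReal a) :
    ∫⁻ p, f p ∂((Measure.pi fun _ : Fin s => D) ⊗ₘ P) ≤
      ENNReal.ofReal (a * Real.exp (s * (17 * ε ^ 2 + 1 * √(δ / ε))) +
        privacyBeta 8 ε δ s * F) := by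
  obtain ⟨M, hM, ρ, hρm, hρle, hρ2, hρ1⟩ := exists_subdensity_of_isDP D hε hε2 hδ hδε s P hP
  have hη : 0 ≤ √(δ / ε) := Real.sqrt_nonneg _
  have h1 := lintegral_le_of_withDensity_le hρm hρle hρ1 hf hfF
  set k : ℝ := s * (17 * ε ^ 2 + 1 * √(δ / ε)) with hk
  have h2 := lintegral_mul_le_exp_mul_lintegral_add
    (ν := (Measure.pi fun _ : Fin s => D).prod M) hρm hf hfF k
  have h3 : ∫⁻ p, f p ∂((Measure.pi fun _ : Fin s => D).prod M) ≤ ENNReal.ofReal a := by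
    rw [lintegral_prod_symm _ hf.aemeasurable]
    refine (lintegral_mono hfa).trans ?_
    simp
  have h4 : ENNReal.ofReal (Real.exp (-k)) *
      ∫⁻ p, ρ p ^ 2 ∂((Measure.pi fun _ : Fin s => D).prod M) ≤
        ENNReal.ofReal (Real.exp (-(s * ε ^ 2))) := by
    calc _ ≤ ENNReal.ofReal (Real.exp (-k)) *
          ENNReal.ofReal (1 + 16 * ε ^ 2 + √(δ / ε)) ^ s := by gcongr
      _ = ENNReal.ofReal (Real.exp (-k) * (1 + 16 * ε ^ 2 + √(δ / ε)) ^ s) := by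
          rw [ENNReal.ofReal_mul (Real.exp_pos _).le, ENNReal.ofReal_pow (by positivity)]
      _ ≤ _ := by
          refine ENNReal.ofReal_le_ofReal ?_
          have h5 : (1 + 16 * ε ^ 2 + √(δ / ε)) ^ s ≤
              Real.exp (s * (16 * ε ^ 2 + √(δ / ε))) := by
            rw [Real.exp_nat_mul]
            gcongr
            linarith [Real.add_one_le_exp (16 * ε ^ 2 + √(δ / ε))]
          calc _ ≤ Real.exp (-k) * Real.exp (s * (16 * ε ^ 2 + √(δ / ε))) := by gcongr
            _ = _ := by
                rw [← Real.exp_add, hk]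
                congr 1
                ring
  calc _ ≤ ENNReal.ofReal (Real.exp k) * ENNReal.ofReal a +
        ENNReal.ofReal F * ENNReal.ofReal (Real.exp (-(s * ε ^ 2))) +
          ENNReal.ofReal F * (s * ENNReal.ofReal (8 * √(δ / ε))) := by
        refine h1.trans (add_le_add (h2.trans ?_) le_rfl)
        gcongr
    _ = _ := by
        rw [← ENNReal.ofReal_natCast s, ← ENNReal.ofReal_mul (Real.exp_pos _).le,
          ← ENNReal.ofReal_mul hF, ← ENNReal.ofReal_mul (by positivity),
          ← ENNReal.ofReal_mul hF, ← ENNReal.ofReal_add (by positivity) (by positivity),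
          ← ENNReal.ofReal_add (by positivity) (by positivity), privacyBeta]
        congr 1
        ring

theorem HoldsWithProbAtLeast.mono {Ω : Type*} [MeasurableSpace Ω] {μ : Measure Ω} {p : ℝ}
    {A B : Set Ω} (h : HoldsWithProbAtLeast μ p A) (hAB : A ⊆ B) :
    HoldsWithProbAtLeast μ p B := by
  obtain ⟨G, hG, hGA, hp⟩ := h
  exact ⟨G, hG, hGA.trans hAB, hp⟩

/-- Markov's inequality for the conditional mean `∫ f(S, θ) dP_S(θ)`. -/
theorem holdsWithProbAtLeast_lintegral_kernel_le {Ω Θ : Type*} [MeasurableSpace Ω]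
    [MeasurableSpace Θ] (μ : Measure Ω) [IsProbabilityMeasure μ] (P : Kernel Ω Θ)
    [IsMarkovKernel P] {f : Ω × Θ → ENNReal} (hf : Measurable f) {A Δ : ℝ} (hA : 0 < A)
    (hΔ : 0 < Δ) (h : ∫⁻ p, f p ∂(μ ⊗ₘ P) ≤ ENNReal.ofReal A) :
    HoldsWithProbAtLeast μ (1 - Δ)
      {S | ∫⁻ θ, f (S, θ) ∂(P S) ≤ ENNReal.ofReal (A / Δ)} := by
  have hg : Measurable fun S => ∫⁻ θ, f (S, θ) ∂(P S) := hf.lintegral_kernel_prod_right'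
  have hG : MeasurableSet {S | ∫⁻ θ, f (S, θ) ∂(P S) ≤ ENNReal.ofReal (A / Δ)} :=
    measurableSet_le hg measurable_const
  refine ⟨_, hG, subset_rfl, ?_⟩
  rw [Measure.lintegral_compProd hf] at h
  have h1 := (mul_meas_ge_le_lintegral (μ := μ) hg (ENNReal.ofReal (A / Δ))).trans h
  have h2 : ENNReal.ofReal A = ENNReal.ofReal (A / Δ) * ENNReal.ofReal Δ := by
    rw [← ENNReal.ofReal_mul (by positivity), div_mul_cancel₀ _ hΔ.ne']
  have hpos : ENNReal.ofReal (A / Δ) ≠ 0 := by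
    simpa using div_pos hA hΔ
  rw [h2, ENNReal.mul_le_mul_iff_right hpos ENNReal.ofReal_ne_top] at h1
  have h3 : μ {S | ∫⁻ θ, f (S, θ) ∂(P S) ≤ ENNReal.ofReal (A / Δ)}ᶜ ≤ ENNReal.ofReal Δ := by
    refine (measure_mono fun S hS => ?_).trans h1
    exact (not_le.1 (show ¬ ∫⁻ θ, f (S, θ) ∂(P S) ≤ ENNReal.ofReal (A / Δ) from hS)).le
  rw [ENNReal.ofReal_sub _ hΔ.le, ENNReal.ofReal_one, tsub_le_iff_right,
    ← prob_add_prob_compl (μ := μ) hG]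
  gcongr

theorem empiricalRisk_mem_Icc {Θ X Y Λ : Type*} {ℓ : Θ → X → Y → Λ → ℝ} {lam : Λ}
    (h01 : ∀ θ x y, ℓ θ x y lam ∈ Set.Icc (0 : ℝ) 1)
    {s : ℕ} (hs : 1 ≤ s) (S : Fin s → X × Y) (θ : Θ) :
    empiricalRisk ℓ lam S θ ∈ Set.Icc (0 : ℝ) 1 := by
  have hs0 : (0 : ℝ) < s := by exact_mod_cast hs
  refine ⟨mul_nonneg (by positivity) (Finset.sum_nonneg fun i _ => (h01 _ _ _).1), ?_⟩
  rw [empiricalRisk, one_div, inv_mul_le_iff₀ hs0]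
  refine (Finset.sum_le_sum fun i _ => (h01 _ _ _).2).trans ?_
  simp

section Risk

variable {Θ X Y Λ : Type*} [MeasurableSpace Θ] [MeasurableSpace X] [MeasurableSpace Y]
  {ℓ : Θ → X → Y → Λ → ℝ} {lam : Λ}

theorem measurable_expectedRisk (hm : Measurable fun q : Θ × X × Y => ℓ q.1 q.2.1 q.2.2 lam)
    (D : Measure (X × Y)) [IsProbabilityMeasure D] : Measurable (expectedRisk ℓ lam D) :=
  (hm.stronglyMeasurable.integral_prod_right' (ν := D)).measurable

theorem measurable_empiricalRisk (hm : Measurable fun q : Θ × X × Y => ℓ q.1 q.2.1 q.2.2 lam)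
    (s : ℕ) : Measurable fun p : (Fin s → X × Y) × Θ => empiricalRisk ℓ lam p.1 p.2 := by
  unfold empiricalRisk
  refine Measurable.const_mul (Finset.measurable_sum _ fun i _ => ?_) _
  exact hm.comp (by fun_prop : Measurable fun p : (Fin s → X × Y) × Θ => (p.2, p.1 i))

theorem expectedRisk_mem_Icc (hm : Measurable fun q : Θ × X × Y => ℓ q.1 q.2.1 q.2.2 lam)
    (h01 : ∀ θ x y, ℓ θ x y lam ∈ Set.Icc (0 : ℝ) 1) (D : Measure (X × Y))
    [IsProbabilityMeasure D] (θ : Θ) : expectedRisk ℓ lam D θ ∈ Set.Icc (0 : ℝ) 1 := by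
  have hi : Integrable (fun z : X × Y => ℓ θ z.1 z.2 lam) D :=
    Integrable.of_mem_Icc 0 1 (hm.comp measurable_prodMk_left).aemeasurable
      (ae_of_all _ fun z => h01 θ _ _)
  refine ⟨integral_nonneg fun z => (h01 θ _ _).1, ?_⟩
  refine (integral_mono hi (integrable_const 1) fun z => (h01 θ _ _).2).trans ?_
  simp

end Risk

theorem mainTheorem2 :
    ∃ c₁ c₂ c₃ : ℝ, 0 < c₁ ∧ 0 < c₂ ∧ 0 < c₃ ∧
      ∀ {Θ X Y Λ : Type*} [MeasurableSpace Θ] [MeasurableSpace X] [MeasurableSpace Y]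
        (ℓ : Θ → X → Y → Λ → ℝ) (lam : Λ)
        (_ : Measurable fun q : Θ × X × Y => ℓ q.1 q.2.1 q.2.2 lam)
        (_ : ∀ θ x y, ℓ θ x y lam ∈ Set.Icc (0 : ℝ) 1)
        (D : Measure (X × Y)) [IsProbabilityMeasure D]
        (s : ℕ) (_ : 1 ≤ s)
        (ε δ : ℝ) (_ : ε ∈ Set.Ioc (0 : ℝ) (1 / 2)) (_ : δ ∈ Set.Ioo 0 ε)
        (P : Kernel (Fin s → X × Y) Θ) [IsMarkovKernel P] (_ : IsDP P ε δ)
        (_ : privacyBeta c₃ ε δ s < 1)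
        (Δ : ℝ) (_ : Δ ∈ Set.Ioo (0 : ℝ) 1),
        HoldsWithProbAtLeast (Measure.pi fun _ : Fin s => D) (1 - Δ)
          {S | ∀ Q : Measure Θ, IsProbabilityMeasure Q →
            -- if the divergence is infinite, so is the right-hand side of the bound
            InformationTheory.klDiv Q (P S) ≠ ⊤ →
            ∫ θ, expectedRisk ℓ lam D θ ∂Q ≤
              ∫ θ, empiricalRisk ℓ lam S θ ∂Q +
                √(1 / (2 * (s : ℝ) - 1) *
                  ((InformationTheory.klDiv Q (P S)).toReal +
                    Real.log
                      ((4 * (s : ℝ) * Real.exp ((s : ℝ) * (c₁ * ε ^ 2 + c₂ * √(δ / ε))) +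
                        privacyBeta c₃ ε δ s * Real.exp (2 * (s : ℝ))) / Δ)))} ∧
        (privacyBeta c₃ ε δ s <
            min 1 ((s : ℝ) * Real.exp ((s : ℝ) * (c₁ * ε ^ 2 + c₂ * √(δ / ε) - 2))) →
          HoldsWithProbAtLeast (Measure.pi fun _ : Fin s => D) (1 - Δ)
            {S | ∀ Q : Measure Θ, IsProbabilityMeasure Q →
              InformationTheory.klDiv Q (P S) ≠ ⊤ →
              ∫ θ, expectedRisk ℓ lam D θ ∂Q ≤
                ∫ θ, empiricalRisk ℓ lam S θ ∂Q +
                  √(1 / (2 * (s : ℝ) - 1) *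
                      ((InformationTheory.klDiv Q (P S)).toReal +
                        Real.log (5 * (s : ℝ) / Δ)) +
                    c₁ * ε ^ 2 + c₂ * √(δ / ε))}) := by
  refine ⟨17, 1, 8, by norm_num, by norm_num, by norm_num, ?_⟩
  intro Θ X Y Λ _ _ _ ℓ lam hm h01 D _ s hs ε δ hε hδ P _ hP _ Δ hΔ
  have hs1 : (1 : ℝ) ≤ s := by exact_mod_cast hs
  set k : ℝ := (s : ℝ) * (17 * ε ^ 2 + 1 * √(δ / ε)) with hk
  set β := privacyBeta 8 ε δ s with hβ
  have hβ0 : 0 ≤ β := by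
    rw [hβ, privacyBeta]
    positivity
  set A : ℝ := 4 * s * Real.exp k + β * Real.exp (2 * s) with hA
  have hA0 : 0 < A := by positivity
  have hRm := measurable_expectedRisk hm D
  have hEm := measurable_empiricalRisk hm s
  have hR := expectedRisk_mem_Icc hm h01 D
  have hE := empiricalRisk_mem_Icc (lam := lam) h01 hs
  set g : (Fin s → X × Y) × Θ → ℝ := fun p =>
    expectedRisk ℓ lam D p.2 - empiricalRisk ℓ lam p.1 p.2 with hg
  have hgm : Measurable g := (hRm.comp measurable_snd).sub hEm
  have hg1 : ∀ p, g p ∈ Set.Icc (-1 : ℝ) 1 := fun p => by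
    have h1 := hR p.2
    have h2 := hE p.1 p.2
    exact ⟨by simp only [hg]; linarith [h1.1, h2.2], by simp only [hg]; linarith [h1.2, h2.1]⟩
  have hjoint : ∫⁻ p, ENNReal.ofReal (Real.exp ((2 * (s : ℝ) - 1) * g p ^ 2))
      ∂((Measure.pi fun _ : Fin s => D) ⊗ₘ P) ≤ ENNReal.ofReal A := by
    refine lintegral_compProd_le_of_isDP D hε.1 hε.2 hδ.1 hδ.2 P hP (by fun_prop)
      (by positivity) (Real.exp_pos _).le (fun p => ?_) fun θ => ?_
    · refine ENNReal.ofReal_le_ofReal (Real.exp_le_exp.2 ?_)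
      have h1 : g p ^ 2 ≤ 1 := (sq_le_one_iff_abs_le_one _).2 (abs_le.2 (hg1 p))
      nlinarith
    · exact lintegral_exp_sq_integral_sub_average_le D (hm.comp measurable_prodMk_left)
        (fun z => h01 θ _ _) hs
  have hgood := holdsWithProbAtLeast_lintegral_kernel_le (Measure.pi fun _ : Fin s => D) P
    (by fun_prop) hA0 hΔ.1 hjoint
  have hbound : ∀ S, ∫⁻ θ, ENNReal.ofReal (Real.exp ((2 * (s : ℝ) - 1) * g (S, θ) ^ 2)) ∂(P S) ≤
      ENNReal.ofReal (A / Δ) → ∀ Q : Measure Θ, IsProbabilityMeasure Q →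
      InformationTheory.klDiv Q (P S) ≠ ⊤ →
      ∫ θ, expectedRisk ℓ lam D θ ∂Q ≤ ∫ θ, empiricalRisk ℓ lam S θ ∂Q +
        √(1 / (2 * (s : ℝ) - 1) *
          ((InformationTheory.klDiv Q (P S)).toReal + Real.log (A / Δ))) := by
    intro S hS Q _ hKL
    have h1 := integral_le_sqrt_klDiv_add_log (g := fun θ => g (S, θ))
      (hgm.comp measurable_prodMk_left) (fun θ => hg1 _) (by linarith) hS hKL
    simp only [hg] at h1
    rw [integral_sub (g := fun θ => empiricalRisk ℓ lam S θ)
      (Integrable.of_mem_Icc 0 1 hRm.aemeasurable (ae_of_all _ hR))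
      (Integrable.of_mem_Icc 0 1 (hEm.comp measurable_prodMk_left).aemeasurable
        (ae_of_all _ (hE S)))] at h1
    linarith
  refine ⟨hgood.mono hbound, fun hsmall => hgood.mono fun S hS Q hQ hKL => ?_⟩
  refine (hbound S hS Q hQ hKL).trans (add_le_add le_rfl (Real.sqrt_le_sqrt ?_))
  have hA5 : A ≤ 5 * s * Real.exp k := by
    have h1 : β * Real.exp (2 * s) ≤
        s * Real.exp (s * (17 * ε ^ 2 + 1 * √(δ / ε) - 2)) * Real.exp (2 * s) := by
      gcongr
      exact (hsmall.trans_le (min_le_right _ _)).le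
    rw [mul_assoc, ← Real.exp_add,
      show (s : ℝ) * (17 * ε ^ 2 + 1 * √(δ / ε) - 2) + 2 * s = k by rw [hk]; ring] at h1
    rw [hA]
    linarith
  have hlog : Real.log (A / Δ) ≤ Real.log (5 * s / Δ) + k := by
    have h1 : 0 < 5 * (s : ℝ) / Δ := div_pos (by positivity) hΔ.1
    rw [← Real.log_exp k, ← Real.log_mul h1.ne' (Real.exp_pos _).ne']
    refine Real.log_le_log (div_pos hA0 hΔ.1) ?_
    rw [div_mul_eq_mul_div]
    exact div_le_div_of_nonneg_right hA5 hΔ.1.le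
  have h2s : 0 < 2 * (s : ℝ) - 1 := by linarith
  -- `s ≤ 2 s - 1`, so the exponent `k = s (…)` contributes at most `(…)` after the division
  have hk' : 1 / (2 * (s : ℝ) - 1) * k ≤ 17 * ε ^ 2 + 1 * √(δ / ε) := by
    rw [one_div, inv_mul_le_iff₀ h2s, hk]
    exact mul_le_mul_of_nonneg_right (by linarith) (by positivity)
  have h3 := mul_le_mul_of_nonneg_left hlog (one_div_nonneg.2 h2s.le)
  rw [mul_add] at h3
  rw [mul_add, mul_add]
  linarith
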